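/- Let $m\ge 3$. For $N\ge 1$ let $B_N=[-N,N]^m\cap\mathbb Z^m$, and let $C_1(B_N)^+$, $C_2(B_N)^+$ be the sets of positively oriented edges and plaquettes with all vertices in $B_N$, and $C_2(B_N)$ the set of plaquettes with both orientations. Ising lattice gauge theory on $B_N$ at $\beta\ge 0$ is the probability measure on $\mathbb Z_2$-valued $1$-forms $\sigma$ on $B_N$ with weights proportional to $\exp\bigl(\beta\sum_{p\in C_2(B_N)}\rho(d\sigma(p))\bigr)$, where $\rho(g)=e^{\pi i g}$ and $d\sigma(p)=\sum_{e\in\partial p}\sigma(e)$; its expectation is $\mathbb E_{N,\beta}$. A loop is a finitely supported $1$-chain $\gamma$ on $\mathbb Z^m$ with coefficients $\gamma(e)\in\{-1,0,1\}$ and $\partial\gamma=0$, and $W_\gamma=\rho(\sigma(\gamma))$. For a loop $\gamma$ in $B_N$ let $\mathcal C_\gamma$ be the set of functions $n\colon C_2(B_N)^+\to\{0,1,2,\dots\}$ such that $\gamma(e)+\sum_{p\,:\,e\in\pm\partial p} n(p)$ is even for every edge $e$ of $B_N$, and let $\operatorname{area}(\gamma)=\min_{n\in\mathcal C_\gamma}\sum_{p}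 n(p)$. Suppose that $0\le\beta<\frac1{4(m-1)}$. Then: 1. For every $N\ge1$ and every loop $\gamma$ in $B_N$, the set $\mathcal C_\gamma$ is non-empty and $$\mathbb E_{N,\beta}[W_\gamma]\le\frac{(4(m-1)\beta)^{\operatorname{area}(\gamma)}}{1-4(m-1)\beta}.$$ 2. For every loop $\gamma$ the limit $\langle W_\gamma\rangle_\beta=\lim_{N\to\infty}\mathbb E_{N,\beta}[W_\gamma]$ exists. 3. For every integer $R\ge1$ the quark potential $V_\beta(R)=-\lim_{T\to\infty}\frac1T\log\langle W_{\gamma_{R,T}}\rangle_\beta$ exists in $[-\infty,\infty]$, where $\gamma_{R,T}$ is the boundary of an axis-parallel rectangle with side lengths $R$ and $T$; it does not depend on the corner and the two directions of the rectangles. Moreover $$V_\beta(R)\ge R\,\log\frac1{4(m-1)\beta},$$ with $\log 0=-\infty$ and $\log\frac10=+\infty$ (relevant only if $\beta=0$). -/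

import Mathlib

open Filter Topology

noncomputable section

namespace IsingGauge

/-! ### Cells of the lattice `ℤ^m` -/

/-- Vertices of `ℤ^m`. -/
abbrev Vertex (m : ℕ) := Fin m → ℤ

/-- The unit vector in direction `i`. -/
def unit {m : ℕ} (i : Fin m) : Vertex m := Pi.single i 1

/-- Positively oriented edges: `(v, i)` is the edge from `v` to `v + unit i`. -/
abbrev Edge (m : ℕ) := Vertex m × Fin m

/-- For `i ≠ j`, the triple `(v, i, j)` is the oriented plaquette at the corner `v` spanned by
`unit i ∧ unit j`. It is positively oriented if `i < j`, and `(v, j, i)` is the same plaquette with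
the opposite orientation. -/
abbrev Plaquette (m : ℕ) := Vertex m × Fin m × Fin m

/-- `1`-chains with integer coefficients: finite formal sums of positively oriented edges. -/
abbrev Chain1 (m : ℕ) := Edge m →₀ ℤ

/-- The box `B_N = [-N, N]^m ∩ ℤ^m`. -/
def box (m N : ℕ) : Finset (Vertex m) :=
  Finset.Icc (fun _ => -(N : ℤ)) (fun _ => (N : ℤ))

/-- The positively oriented edges whose endpoints lie in `B_N`. -/
def boxEdges (m N : ℕ) : Finset (Edge m) :=
  (box m N ×ˢ Finset.univ).filter fun e => e.1 + unit e.2 ∈ box m N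

/-- All oriented plaquettes (both orientations) whose four corners lie in `B_N`. -/
def boxPlaquettes (m N : ℕ) : Finset (Plaquette m) :=
  (box m N ×ˢ (Finset.univ ×ˢ Finset.univ)).filter fun p =>
    p.2.1 ≠ p.2.2 ∧ p.1 + unit p.2.1 ∈ box m N ∧ p.1 + unit p.2.2 ∈ box m N ∧
      p.1 + unit p.2.1 + unit p.2.2 ∈ box m N

/-- The positively oriented plaquettes whose four corners lie in `B_N`. -/
def boxPosPlaquettes (m N : ℕ) : Finset (Plaquette m) :=
  (boxPlaquettes m N).filter fun p => p.2.1 < p.2.2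

/-- The oriented boundary of an oriented plaquette. -/
def plaquetteBoundary {m : ℕ} (p : Plaquette m) : Chain1 m :=
  Finsupp.single (p.1, p.2.1) 1 + Finsupp.single (p.1 + unit p.2.1, p.2.2) 1
    - Finsupp.single (p.1 + unit p.2.2, p.2.1) 1 - Finsupp.single (p.1, p.2.2) 1

/-- The boundary of a `1`-chain, as a `0`-chain. -/
def boundary {m : ℕ} (γ : Chain1 m) : Vertex m →₀ ℤ :=
  γ.sum fun e a => Finsupp.single (e.1 + unit e.2) a - Finsupp.single e.1 a

/-- A loop: a finitely supported `1`-chain with coefficients in `{-1, 0, 1}` and no boundary. -/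
def IsLoop {m : ℕ} (γ : Chain1 m) : Prop :=
  (∀ e, γ e = -1 ∨ γ e = 0 ∨ γ e = 1) ∧ boundary γ = 0

/-! ### Ising lattice gauge theory on `B_N` -/

/-- Gauge field configurations: `ℤ₂`-valued `1`-forms on `B_N`, given by their values on the
positively oriented edges (the value on a reversed edge is the negative). -/
abbrev Config (m N : ℕ) := boxEdges m N → ZMod 2

/-- The value `σ(γ)` of a `1`-form on a `1`-chain; if `γ = ∂p`, this is `dσ(p)`. -/
def evalChain {m N : ℕ} (σ : Config m N) (γ : Chain1 m) : ZMod 2 :=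
  ∑ e : boxEdges m N, (γ e.1 : ZMod 2) * σ e

/-- The representation `g ↦ exp(π i g)` of `ℤ₂`, which takes the real values `1` and `-1`. -/
def rho (g : ZMod 2) : ℝ := (-1) ^ g.val

/-- The Wilson action; the sum runs over the plaquettes with both orientations. -/
def action {m N : ℕ} (σ : Config m N) : ℝ :=
  -∑ p ∈ boxPlaquettes m N, rho (evalChain σ (plaquetteBoundary p))

/-- The partition function. -/
def partition (m N : ℕ) (β : ℝ) : ℝ :=
  ∑ σ : Config m N, Real.exp (-β * action σ)

/-- Expectation with respect to the Ising lattice gauge theory measure on `B_N`. -/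
def expectation (m N : ℕ) (β : ℝ) (f : Config m N → ℝ) : ℝ :=
  ∑ σ : Config m N, f σ * ((partition m N β)⁻¹ * Real.exp (-β * action σ))

/-- The Wilson loop variable. -/
def wilson {m N : ℕ} (γ : Chain1 m) (σ : Config m N) : ℝ := rho (evalChain σ γ)

/-- The infinite volume limit of the Wilson loop expectation. -/
def wilsonLimit (m : ℕ) (β : ℝ) (γ : Chain1 m) : ℝ :=
  limUnder atTop fun N : ℕ => expectation m N β (wilson γ)

/-! ### Currents and area -/

/-- Nonnegative integer-valued `2`-forms on `B_N`, given on positively oriented plaquettes. -/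
abbrev Current (m N : ℕ) := boxPosPlaquettes m N → ℕ

/-- The currents with source `γ`: at each edge `e` of `B_N`, the sum of `γ(e)` and of the values of
`n` on the plaquettes containing `e` in their boundary is even. -/
def currents {m : ℕ} (N : ℕ) (γ : Chain1 m) : Set (Current m N) :=
  {n | ∀ e ∈ boxEdges m N,
    γ e + ∑ p : boxPosPlaquettes m N with plaquetteBoundary p.1 e ≠ 0, (n p : ℤ) ≡ 0 [ZMOD 2]}

/-- The area of `γ`: the minimal total mass of a current on `B_N` with source `γ`. -/
def area {m : ℕ} (N : ℕ) (γ : Chain1 m) : ℕ :=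
  sInf {a | ∃ n ∈ currents N γ, ∑ p, n p = a}

/-! ### The quark potential -/

/-- The boundary of the axis-parallel rectangle with corner `v`, side length `R` in direction `i`
and side length `T` in direction `j`. -/
def rectangle {m : ℕ} (v : Vertex m) (i j : Fin m) (R T : ℕ) : Chain1 m :=
  ∑ k ∈ Finset.range R, Finsupp.single (v + k • unit i, i) 1
    + ∑ l ∈ Finset.range T, Finsupp.single (v + R • unit i + l • unit j, j) 1
    - ∑ k ∈ Finset.range R, Finsupp.single (v + T • unit j + k • unit i, i) 1
    - ∑ l ∈ Finset.range T, Finsupp.single (v + l • unit j, j) 1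

/-- `V` is the quark potential at `β` and `R`: for rectangles of side lengths `R` and `T`, in any
position, `-(1 / T) log ⟨W⟩_β` tends to `V` as `T → ∞`. Here `log 0 = -∞`. -/
def IsQuarkPotential (m : ℕ) (β : ℝ) (R : ℕ) (V : EReal) : Prop :=
  ∀ (v : Vertex m) (i j : Fin m), i ≠ j →
    Tendsto (fun T : ℕ =>
        -ENNReal.log (ENNReal.ofReal (wilsonLimit m β (rectangle v i j R T))) / (T : EReal))
      atTop (𝓝 V)

end IsingGauge

end

noncomputable section

namespace IsingGauge

/-! Put t = tanh β. Since ρ takes the values ±1, exp(βρ) = cosh β (1 + tρ). Expanding the product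
over oriented plaquettes and summing over σ kills every term except the plaquette sets S whose
boundary mod 2 is the given chain. Hence E[W_γ] = Z(γ)/Z(0), where Z(c) is the sum of t^|S| over the
S with ∂S = c (`currentSum`, `expectation_wilson`).

Area law: if c contains an edge e, every S with ∂S = c uses one of the at most 4(m-1) oriented
plaquettes at e. Removing it replaces c by c + ∂p at the price of a factor t. While c is not a sum
of too few plaquette boundaries it stays nonzero, so this can be repeated area(γ) times, after which
Z(c) ≤ Z(0) ends the argument (`currentSum_le_pow`); finally t ≤ β. Currents exist by the Poincaré
lemma on a box (`exists_potential`), applied to the tautological 1-form with values in chains modulo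
plaquette boundaries.

Limits: Griffiths' second inequality (`currentSum_mul_le`) makes Z(c)/Z(0) increasing in the set of
plaquettes and supermultiplicative in c. So the infinite volume limit exists and is a supremum over
all finite plaquette sets, which makes it invariant under lattice symmetries. For rectangles, -log
of it is subadditive in T, and Fekete's lemma gives the quark potential. Its lower bound is the area
law together with the fact that spanning an R × T rectangle takes at least RT plaquettes
(`mul_le_card_of_sum_eq_rectangle`). -/

theorem rho_add (x y : ZMod 2) : rho (x + y) = rho x * rho y := by
  have h : ∀ x : ZMod 2, x = 0 ∨ x = 1 := by decide
  have h0 : (0 : ZMod 2).val = 0 := rfl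
  have h1 : (1 : ZMod 2).val = 1 := rfl
  have h2 : (1 + 1 : ZMod 2).val = 0 := rfl
  rcases h x with rfl | rfl <;> rcases h y with rfl | rfl <;> simp [rho, h0, h1, h2]

theorem rho_zero : rho 0 = 1 := by simp [rho]

theorem rho_one : rho 1 = -1 := by
  have h1 : (1 : ZMod 2).val = 1 := rfl
  simp [rho, h1]

theorem rho_eq_one_or_neg_one (x : ZMod 2) : rho x = 1 ∨ rho x = -1 := by
  have h : ∀ x : ZMod 2, x = 0 ∨ x = 1 := by decide
  rcases h x with rfl | rfl
  · exact Or.inl rho_zero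
  · exact Or.inr rho_one

theorem neg_one_le_rho (x : ZMod 2) : -1 ≤ rho x := by
  rcases rho_eq_one_or_neg_one x with h | h <;> rw [h]
  norm_num

theorem rho_le_one (x : ZMod 2) : rho x ≤ 1 := by
  rcases rho_eq_one_or_neg_one x with h | h <;> rw [h]
  norm_num

theorem rho_sum {ι : Type*} (s : Finset ι) (f : ι → ZMod 2) :
    rho (∑ i ∈ s, f i) = ∏ i ∈ s, rho (f i) := by
  classical
  induction s using Finset.induction_on with
  | empty => simp [rho_zero]
  | insert a s ha ih => rw [Finset.sum_insert ha, Finset.prod_insert ha, rho_add, ih]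

/-! ### Cochains, mod 2 chains and character orthogonality -/

section Pairing

variable {E : Type*}

/-- The pairing of a `ℤ₂`-valued cochain on a finite set of cells with a mod 2 chain. -/
def pairing {F : Finset E} (σ : F → ZMod 2) (a : E →₀ ZMod 2) : ZMod 2 :=
  ∑ e : F, a e.1 * σ e

theorem pairing_zero {F : Finset E} (σ : F → ZMod 2) : pairing σ 0 = 0 := by simp [pairing]

theorem pairing_add {F : Finset E} (σ : F → ZMod 2) (a b : E →₀ ZMod 2) :
    pairing σ (a + b) = pairing σ a + pairing σ b := by
  simp [pairing, add_mul, Finset.sum_add_distrib]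

theorem add_pairing {F : Finset E} (σ τ : F → ZMod 2) (a : E →₀ ZMod 2) :
    pairing (σ + τ) a = pairing σ a + pairing τ a := by
  simp [pairing, mul_add, Finset.sum_add_distrib]

theorem pairing_sum {ι : Type*} {F : Finset E} (σ : F → ZMod 2) (s : Finset ι)
    (f : ι → E →₀ ZMod 2) : pairing σ (∑ i ∈ s, f i) = ∑ i ∈ s, pairing σ (f i) := by
  classical
  induction s using Finset.induction_on with
  | empty => simp [pairing_zero]
  | insert a s ha ih => rw [Finset.sum_insert ha, Finset.sum_insert ha, pairing_add, ih]

theorem chain_add_self (a : E →₀ ZMod 2) : a + a = 0 := by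
  ext e
  exact CharTwo.add_self_eq_zero _

theorem chain_add_eq_iff (a b c : E →₀ ZMod 2) : a + b = c ↔ a = c + b := by
  constructor
  · rintro rfl
    rw [add_assoc, chain_add_self, add_zero]
  · rintro rfl
    rw [add_assoc, chain_add_self, add_zero]

-- Orthogonality of characters: flipping σ at one cell in the support of a nonzero `a` changes the
-- sign of every term, so the sum equals its own negative.
open scoped Classical in
theorem sum_rho_pairing [DecidableEq E] (F : Finset E) (a : E →₀ ZMod 2) (ha : a.support ⊆ F) :
    ∑ σ : F → ZMod 2, rho (pairing σ a) = if a = 0 then (2 : ℝ) ^ F.card else 0 := by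
  split_ifs with h
  · subst h
    simp [pairing_zero, rho_zero, ZMod.card]
  · obtain ⟨e, he⟩ := Finsupp.ne_iff.1 h
    have heF : e ∈ F := ha (by simpa using he)
    have he1 : a e = 1 := by
      have : ∀ x : ZMod 2, x ≠ 0 → x = 1 := by decide
      exact this _ he
    have key : ∀ σ : F → ZMod 2,
        rho (pairing (σ + Pi.single ⟨e, heF⟩ 1) a) = -rho (pairing σ a) := by
      intro σ
      have : pairing (Pi.single ⟨e, heF⟩ 1) a = 1 := by
        simp [pairing, Pi.single_apply, he1]
      rw [add_pairing, this, rho_add, rho_one, mul_neg_one]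
    have hsum := Equiv.sum_comp (Equiv.addRight (Pi.single ⟨e, heF⟩ 1 : F → ZMod 2))
      (fun σ : F → ZMod 2 => rho (pairing σ a))
    simp only [Equiv.coe_addRight, key, Finset.sum_neg_distrib] at hsum
    linarith

end Pairing

/-! ### High-temperature expansion, Griffiths inequalities and decay for abstract plaquettes -/

section CurrentSum

variable {E ι : Type*} (d : ι → E →₀ ZMod 2)

-- The coefficients may vary with the plaquette because the proof of Griffiths' inequality uses
-- weights that depend on a second configuration.
open scoped Classical in
theorem sum_rho_mul_prod [DecidableEq E] (F : Finset E) (P : Finset ι) (α β : ι → ℝ) (c : E →₀ ZMod 2)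
    (hc : c.support ⊆ F) (hd : ∀ p ∈ P, (d p).support ⊆ F) :
    ∑ σ : F → ZMod 2, rho (pairing σ c) * ∏ p ∈ P, (β p * rho (pairing σ (d p)) + α p) =
      2 ^ F.card * ∑ S ∈ P.powerset,
        if ∑ p ∈ S, d p = c then (∏ p ∈ S, β p) * ∏ p ∈ P \ S, α p else 0 := by
  simp_rw [Finset.prod_add, Finset.mul_sum]
  rw [Finset.sum_comm]
  refine Finset.sum_congr rfl fun S hS => ?_
  rw [Finset.mem_powerset] at hS
  have h1 : ∀ σ : F → ZMod 2,
      rho (pairing σ c) * ((∏ p ∈ S, β p * rho (pairing σ (d p))) * ∏ p ∈ P \ S, α p) =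
        rho (pairing σ (c + ∑ p ∈ S, d p)) * ((∏ p ∈ S, β p) * ∏ p ∈ P \ S, α p) := by
    intro σ
    rw [pairing_add, rho_add, pairing_sum, rho_sum, Finset.prod_mul_distrib]
    ring
  have hsupp : (c + ∑ p ∈ S, d p).support ⊆ F := by
    refine Finsupp.support_add.trans (Finset.union_subset hc ?_)
    exact Finsupp.support_finsetSum.trans (Finset.biUnion_subset.2 fun p hp => hd p (hS hp))
  simp_rw [h1]
  rw [← Finset.sum_mul, sum_rho_pairing F _ hsupp]
  have h2 : c + ∑ p ∈ S, d p = 0 ↔ ∑ p ∈ S, d p = c := by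
    rw [chain_add_eq_iff, zero_add, eq_comm]
  simp only [h2]
  split_ifs <;> simp

open scoped Classical in
/-- The sum of `t ^ |S|` over the sets `S` of plaquettes in `P` with boundary `c`. -/
def currentSum (t : ℝ) (P : Finset ι) (c : E →₀ ZMod 2) : ℝ :=
  ∑ S ∈ P.powerset, if ∑ p ∈ S, d p = c then t ^ S.card else 0

theorem sum_rho_mul_prod_one_add [DecidableEq E] (t : ℝ) (F : Finset E) (P : Finset ι) (c : E →₀ ZMod 2)
    (hc : c.support ⊆ F) (hd : ∀ p ∈ P, (d p).support ⊆ F) :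
    ∑ σ : F → ZMod 2, rho (pairing σ c) * ∏ p ∈ P, (t * rho (pairing σ (d p)) + 1) =
      2 ^ F.card * currentSum d t P c := by
  classical
  rw [sum_rho_mul_prod d F P (fun _ => 1) (fun _ => t) c hc hd]
  simp only [currentSum, Finset.prod_const, one_pow, mul_one]
  congr! 3

theorem sum_rho_mul_prod_nonneg [DecidableEq E] (F : Finset E) (P : Finset ι) (α β : ι → ℝ) (c : E →₀ ZMod 2)
    (hc : c.support ⊆ F) (hd : ∀ p ∈ P, (d p).support ⊆ F) (hα : ∀ p, 0 ≤ α p)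
    (hβ : ∀ p, 0 ≤ β p) :
    0 ≤ ∑ σ : F → ZMod 2, rho (pairing σ c) * ∏ p ∈ P, (β p * rho (pairing σ (d p)) + α p) := by
  classical
  rw [sum_rho_mul_prod d F P α β c hc hd]
  refine mul_nonneg (by positivity) (Finset.sum_nonneg fun S _ => ?_)
  split_ifs
  · exact mul_nonneg (Finset.prod_nonneg fun p _ => hβ p) (Finset.prod_nonneg fun p _ => hα p)
  · exact le_rfl

variable {d} {t : ℝ}

theorem currentSum_nonneg (ht : 0 ≤ t) (P : Finset ι) (c : E →₀ ZMod 2) :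
    0 ≤ currentSum d t P c := by
  classical
  refine Finset.sum_nonneg fun S _ => ?_
  split_ifs <;> positivity

theorem currentSum_empty_of_ne {c : E →₀ ZMod 2} (hc : c ≠ 0) :
    currentSum d t ∅ c = 0 := by
  simp [currentSum, hc.symm]

theorem currentSum_empty_zero : currentSum d t ∅ 0 = 1 := by
  simp [currentSum]

/-- Split the sets S according to whether they contain q; modulo 2, removing q adds `d q` to the
prescribed boundary. Most later inequalities rest on this recursion. -/
theorem currentSum_insert [DecidableEq ι] {q : ι} {P : Finset ι} (hq : q ∉ P)
    (c : E →₀ ZMod 2) :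
    currentSum d t (insert q P) c = currentSum d t P c + t * currentSum d t P (c + d q) := by
  classical
  unfold currentSum
  rw [Finset.sum_powerset_insert hq, Finset.mul_sum]
  congr 1
  refine Finset.sum_congr rfl fun S hS => ?_
  have hqS : q ∉ S := fun h => hq (Finset.mem_powerset.1 hS h)
  rw [Finset.sum_insert hqS, Finset.card_insert_of_notMem hqS, add_comm (d q)]
  simp only [chain_add_eq_iff]
  split_ifs <;> ring

theorem currentSum_le_insert [DecidableEq ι] (ht : 0 ≤ t) {q : ι} {P : Finset ι} (hq : q ∉ P)
    (c : E →₀ ZMod 2) : currentSum d t P c ≤ currentSum d t (insert q P) c := by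
  rw [currentSum_insert hq]
  exact le_add_of_nonneg_right (mul_nonneg ht (currentSum_nonneg ht _ _))

theorem currentSum_zero_pos (ht : 0 ≤ t) (P : Finset ι) : 0 < currentSum d t P 0 := by
  classical
  induction P using Finset.induction_on with
  | empty => simp [currentSum_empty_zero]
  | insert q P hq ih => exact ih.trans_le (currentSum_le_insert ht hq 0)

/-- A finite set of cells containing the supports of given chains. -/
theorem exists_support_subset (P : Finset ι) (a b : E →₀ ZMod 2) :
    ∃ F : Finset E, a.support ⊆ F ∧ b.support ⊆ F ∧ ∀ p ∈ P, (d p).support ⊆ F := by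
  classical
  refine ⟨(a.support ∪ b.support) ∪ P.biUnion fun p => (d p).support, ?_, ?_, fun p hp => ?_⟩
  · exact Finset.subset_union_left.trans Finset.subset_union_left
  · exact Finset.subset_union_right.trans Finset.subset_union_left
  · exact (Finset.subset_biUnion_of_mem (fun p => (d p).support) hp).trans
      Finset.subset_union_right

theorem one_add_mul_rho_nonneg (ht : 0 ≤ t) (ht1 : t ≤ 1) (x : ZMod 2) :
    0 ≤ t * rho x + 1 := by
  rcases rho_eq_one_or_neg_one x with h | h <;> rw [h] <;> linarith

/-- Back on the spin side: the weights are nonnegative because t ≤ 1, and ρ ≤ 1. -/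
theorem currentSum_le_zero (ht : 0 ≤ t) (ht1 : t ≤ 1) (P : Finset ι) (c : E →₀ ZMod 2) :
    currentSum d t P c ≤ currentSum d t P 0 := by
  classical
  obtain ⟨F, hF, -, hP⟩ := exists_support_subset (d := d) P c 0
  have h1 := sum_rho_mul_prod_one_add d t F P c hF hP
  have h2 := sum_rho_mul_prod_one_add d t F P 0 (by simp) hP
  have h3 : (2 : ℝ) ^ F.card * currentSum d t P c ≤ 2 ^ F.card * currentSum d t P 0 := by
    rw [← h1, ← h2]
    refine Finset.sum_le_sum fun σ _ => ?_
    rw [pairing_zero, rho_zero]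
    exact mul_le_mul_of_nonneg_right (rho_le_one _)
      (Finset.prod_nonneg fun p _ => one_add_mul_rho_nonneg ht ht1 _)
  exact le_of_mul_le_mul_left h3 (by positivity)

/-- Griffiths' second inequality. -/
theorem currentSum_mul_le (ht : 0 ≤ t) (ht1 : t ≤ 1) (P : Finset ι) (a b : E →₀ ZMod 2) :
    currentSum d t P a * currentSum d t P b ≤
      currentSum d t P (a + b) * currentSum d t P 0 := by
  classical
  obtain ⟨F, ha, hb, hP⟩ := exists_support_subset (d := d) P a b
  have hab : (a + b).support ⊆ F := Finsupp.support_add.trans (Finset.union_subset ha hb)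
  have hA := sum_rho_mul_prod_one_add d t F P a ha hP
  have hB := sum_rho_mul_prod_one_add d t F P b hb hP
  have hAB := sum_rho_mul_prod_one_add d t F P (a + b) hab hP
  have h0 := sum_rho_mul_prod_one_add d t F P 0 (by simp) hP
  set w : (F → ZMod 2) → ℝ := fun σ => ∏ p ∈ P, (t * rho (pairing σ (d p)) + 1) with hw
  have hshift : ∀ (f : (F → ZMod 2) → ℝ) (σ : F → ZMod 2), ∑ τ, f τ = ∑ τ, f (σ + τ) :=
    fun f σ => (Equiv.sum_comp (Equiv.addLeft σ) f).symm
  -- Two independent copies are written as σ and σ + τ. Since ρ(σ)² = 1, the product of the two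
  -- factors at p is affine in ρ(σ(∂p)), and its coefficients are nonnegative for fixed τ because
  -- ρ(τ(∂p)) ≥ -1 and 0 ≤ t ≤ 1.
  have hww : ∀ σ τ : F → ZMod 2, w σ * w (σ + τ) =
      ∏ p ∈ P, ((t * (1 + rho (pairing τ (d p)))) * rho (pairing σ (d p)) +
        (1 + t ^ 2 * rho (pairing τ (d p)))) := by
    intro σ τ
    simp only [hw, ← Finset.prod_mul_distrib]
    refine Finset.prod_congr rfl fun p _ => ?_
    rw [add_pairing, rho_add]
    rcases rho_eq_one_or_neg_one (pairing σ (d p)) with h | h <;> rw [h] <;> ring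
  -- This sum is Z(a+b)Z(0) - Z(a)Z(b) up to the positive factor from summing over spins, because
  -- ρ(σ(a)) ρ((σ+τ)(b)) = ρ(σ(a+b)) ρ(τ(b)). For each τ the inner sum has nonnegative expansion
  -- coefficients.
  have key : 0 ≤ ∑ τ : F → ZMod 2, (1 - rho (pairing τ b)) *
      ∑ σ : F → ZMod 2, rho (pairing σ (a + b)) * (w σ * w (σ + τ)) := by
    refine Finset.sum_nonneg fun τ _ => mul_nonneg (sub_nonneg.2 (rho_le_one _)) ?_
    simp_rw [hww]
    refine sum_rho_mul_prod_nonneg d F P _ _ (a + b) hab hP (fun p => ?_) fun p => ?_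
    · have := neg_one_le_rho (pairing τ (d p))
      nlinarith [sq_nonneg t]
    · have := neg_one_le_rho (pairing τ (d p))
      exact mul_nonneg ht (by linarith)
  have h1 : (∑ σ, rho (pairing σ (a + b)) * w σ) * (∑ σ, rho (pairing σ 0) * w σ) =
      ∑ τ : F → ZMod 2, ∑ σ : F → ZMod 2, rho (pairing σ (a + b)) * (w σ * w (σ + τ)) := by
    rw [Finset.sum_mul, Finset.sum_comm]
    refine Finset.sum_congr rfl fun σ _ => ?_
    rw [hshift _ σ, Finset.mul_sum]
    refine Finset.sum_congr rfl fun τ _ => ?_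
    rw [pairing_zero, rho_zero]
    ring
  have h2 : (∑ σ, rho (pairing σ a) * w σ) * (∑ σ, rho (pairing σ b) * w σ) =
      ∑ τ : F → ZMod 2, rho (pairing τ b) *
        ∑ σ : F → ZMod 2, rho (pairing σ (a + b)) * (w σ * w (σ + τ)) := by
    conv_rhs => simp only [Finset.mul_sum]
    rw [Finset.sum_mul, Finset.sum_comm]
    refine Finset.sum_congr rfl fun σ _ => ?_
    rw [hshift _ σ, Finset.mul_sum]
    refine Finset.sum_congr rfl fun τ _ => ?_
    rw [add_pairing, rho_add, pairing_add, rho_add]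
    ring
  have h3 : (∑ σ, rho (pairing σ a) * w σ) * (∑ σ, rho (pairing σ b) * w σ) ≤
      (∑ σ, rho (pairing σ (a + b)) * w σ) * (∑ σ, rho (pairing σ 0) * w σ) := by
    rw [h1, h2, ← sub_nonneg, ← Finset.sum_sub_distrib]
    refine key.trans_eq (Finset.sum_congr rfl fun τ _ => ?_)
    ring
  rw [hA, hB, hAB, h0] at h3
  have hpos : (0 : ℝ) < 2 ^ F.card * 2 ^ F.card := by positivity
  refine le_of_mul_le_mul_left ?_ hpos
  linarith

/-- The normalised current sum, which is the expectation of the Wilson variable of `c`. -/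
def currentRatio (d : ι → E →₀ ZMod 2) (t : ℝ) (P : Finset ι) (c : E →₀ ZMod 2) : ℝ :=
  currentSum d t P c / currentSum d t P 0

theorem currentRatio_le_one (ht : 0 ≤ t) (ht1 : t ≤ 1) (P : Finset ι) (c : E →₀ ZMod 2) :
    currentRatio d t P c ≤ 1 :=
  div_le_one_of_le₀ (currentSum_le_zero ht ht1 P c) (currentSum_nonneg ht _ _)

theorem currentRatio_zero (ht : 0 ≤ t) (P : Finset ι) : currentRatio d t P 0 = 1 :=
  div_self (currentSum_zero_pos ht P).ne'

theorem currentRatio_mul_le (ht : 0 ≤ t) (ht1 : t ≤ 1) (P : Finset ι) (a b : E →₀ ZMod 2) :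
    currentRatio d t P a * currentRatio d t P b ≤ currentRatio d t P (a + b) := by
  have h0 := currentSum_zero_pos (d := d) ht P
  unfold currentRatio
  rw [div_mul_div_comm, div_le_div_iff₀ (mul_pos h0 h0) h0]
  have := mul_le_mul_of_nonneg_right (currentSum_mul_le (d := d) ht ht1 P a b) h0.le
  linarith

/-- After the recursion and clearing denominators this is Z(c) Z(∂q) ≤ Z(c + ∂q) Z(0), which is
Griffiths' second inequality. -/
theorem currentRatio_le_insert [DecidableEq ι] (ht : 0 ≤ t) (ht1 : t ≤ 1) (q : ι) (P : Finset ι)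
    (c : E →₀ ZMod 2) : currentRatio d t P c ≤ currentRatio d t (insert q P) c := by
  by_cases hq : q ∈ P
  · rw [Finset.insert_eq_of_mem hq]
  · unfold currentRatio
    rw [div_le_div_iff₀ (currentSum_zero_pos ht _) (currentSum_zero_pos ht _),
      currentSum_insert hq, currentSum_insert hq, zero_add]
    nlinarith [currentSum_mul_le (d := d) ht ht1 P c (d q)]

theorem currentRatio_insert_of_eq_zero [DecidableEq ι] (ht : 0 ≤ t) {q : ι} (hd : d q = 0)
    (P : Finset ι) (c : E →₀ ZMod 2) :
    currentRatio d t (insert q P) c = currentRatio d t P c := by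
  by_cases hq : q ∈ P
  · rw [Finset.insert_eq_of_mem hq]
  · unfold currentRatio
    rw [currentSum_insert hq, currentSum_insert hq, hd, add_zero, add_zero, ← one_add_mul,
      ← one_add_mul, mul_div_mul_left _ _ (by positivity)]

/-- The alternative `d p = 0` admits degenerate plaquettes (v, i, i): they lie in no box but do
occur in arbitrary finite sets of plaquettes, and they cancel in the ratio. -/
theorem currentRatio_mono (ht : 0 ≤ t) (ht1 : t ≤ 1) {P Q : Finset ι}
    (h : ∀ p ∈ P, p ∈ Q ∨ d p = 0) (c : E →₀ ZMod 2) :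
    currentRatio d t P c ≤ currentRatio d t Q c := by
  classical
  have h1 : ∀ S : Finset ι, currentRatio d t P c ≤ currentRatio d t (S ∪ P) c := by
    intro S
    induction S using Finset.induction_on with
    | empty => simp
    | insert q S _ ih =>
      rw [Finset.insert_union]
      exact ih.trans (currentRatio_le_insert ht ht1 _ _ _)
  have h2 : ∀ S : Finset ι, (∀ p ∈ S, p ∈ Q ∨ d p = 0) →
      currentRatio d t (S ∪ Q) c = currentRatio d t Q c := by
    intro S
    induction S using Finset.induction_on with
    | empty => simp
    | insert q S _ ih =>
      intro hS
      rw [Finset.insert_union]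
      have ihS := ih fun p hp => hS p (Finset.mem_insert_of_mem hp)
      rcases hS q (Finset.mem_insert_self _ _) with hq | hq
      · rw [Finset.insert_eq_of_mem (Finset.mem_union_right _ hq), ihS]
      · rw [currentRatio_insert_of_eq_zero ht hq, ihS]
  rw [← h2 P h, Finset.union_comm]
  exact h1 Q

-- A set with boundary c must contain a plaquette at e, since c does not vanish there; removing one
-- such plaquette leaves a set with boundary c + ∂p. The bound overcounts, as several plaquettes at
-- e may be available.
open scoped Classical in
theorem currentSum_le_sum (ht : 0 ≤ t) (P : Finset ι) (e : E) (c : E →₀ ZMod 2) (hc : c e ≠ 0) :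
    currentSum d t P c ≤ t * ∑ p ∈ P with d p e ≠ 0, currentSum d t P (c + d p) := by
  induction P using Finset.induction_on generalizing c with
  | empty =>
    have : c ≠ 0 := by
      rintro rfl
      exact hc rfl
    simp [currentSum_empty_of_ne this]
  | insert q P hq ih =>
    rw [Finset.filter_insert]
    split_ifs with hqe
    · rw [currentSum_insert hq, Finset.sum_insert (by simp [hq]), mul_add, add_comm]
      refine add_le_add (mul_le_mul_of_nonneg_left (currentSum_le_insert ht hq _) ht)
        ((ih c hc).trans (mul_le_mul_of_nonneg_left ?_ ht))
      exact Finset.sum_le_sum fun p _ => currentSum_le_insert ht hq _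
    · have hqc : (c + d q) e ≠ 0 := by
        rw [not_not] at hqe
        simpa [hqe] using hc
      rw [currentSum_insert hq]
      simp_rw [currentSum_insert hq]
      rw [Finset.sum_add_distrib, ← Finset.mul_sum, mul_add]
      refine add_le_add (ih c hc) (mul_le_mul_of_nonneg_left ?_ ht)
      simp_rw [add_right_comm c _ (d q)]
      exact ih _ hqc

open scoped Classical in
/-- If every cell lies on at most `D` plaquettes of `P`, and `c` is not the sum of fewer than `k`
plaquette boundaries, then the current sum decays like `(D t) ^ k`. -/
theorem currentSum_le_pow (ht : 0 ≤ t) (ht1 : t ≤ 1) (P : Finset ι) (D : ℝ) (hD0 : 0 ≤ D)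
    (hD : ∀ e : E, ((P.filter fun p => d p e ≠ 0).card : ℝ) ≤ D) (k : ℕ) (c : E →₀ ZMod 2)
    (hc : ∀ s : Multiset ι, (∀ p ∈ s, p ∈ P) → s.card < k → (s.map d).sum ≠ c) :
    currentSum d t P c ≤ (D * t) ^ k * currentSum d t P 0 := by
  induction k generalizing c with
  | zero => simpa using currentSum_le_zero ht ht1 P c
  | succ k ih =>
    have hc0 : c ≠ 0 := by
      rintro rfl
      exact hc 0 (by simp) (by simp) (by simp)
    obtain ⟨e, he⟩ := Finsupp.ne_iff.1 hc0
    have hstep : ∀ p ∈ P.filter (fun p => d p e ≠ 0),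
        currentSum d t P (c + d p) ≤ (D * t) ^ k * currentSum d t P 0 := by
      intro p hp
      -- A short representation of c + ∂p, extended by p, would be a short representation of c.
      -- Multisets are needed because p may already occur in s.
      refine ih _ fun s hs hcard hsum => ?_
      refine hc (p ::ₘ s) ?_ ?_ ?_
      · simpa using ⟨(Finset.mem_filter.1 hp).1, hs⟩
      · simpa using hcard
      · rw [Multiset.map_cons, Multiset.sum_cons, hsum, add_comm, add_assoc, chain_add_self,
          add_zero]
    have hnn : 0 ≤ (D * t) ^ k * currentSum d t P 0 :=
      mul_nonneg (by positivity) (currentSum_nonneg ht _ _)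
    calc currentSum d t P c
        ≤ t * ∑ p ∈ P with d p e ≠ 0, currentSum d t P (c + d p) := currentSum_le_sum ht P e c he
      _ ≤ t * ((P.filter fun p => d p e ≠ 0).card • ((D * t) ^ k * currentSum d t P 0)) :=
          mul_le_mul_of_nonneg_left (Finset.sum_le_card_nsmul _ _ _ hstep) ht
      _ ≤ t * (D * ((D * t) ^ k * currentSum d t P 0)) := by
          rw [nsmul_eq_mul]
          exact mul_le_mul_of_nonneg_left (mul_le_mul_of_nonneg_right (hD e) hnn) ht
      _ = (D * t) ^ (k + 1) * currentSum d t P 0 := by ring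

theorem currentSum_map_equiv {E' ι' : Type*} {d' : ι' → E' →₀ ZMod 2} (φ : ι ≃ ι')
    (ψ : (E →₀ ZMod 2) ≃+ (E' →₀ ZMod 2)) (h : ∀ p, d' (φ p) = ψ (d p)) (P : Finset ι)
    (c : E →₀ ZMod 2) :
    currentSum d' t (P.map φ.toEmbedding) (ψ c) = currentSum d t P c := by
  classical
  induction P using Finset.induction_on generalizing c with
  | empty =>
    have : 0 = ψ c ↔ 0 = c := by rw [eq_comm, map_eq_zero_iff ψ ψ.injective, eq_comm]
    simp [currentSum, this]
  | insert q P hq ih =>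
    have hq' : φ q ∉ P.map φ.toEmbedding := by simpa using hq
    rw [Finset.map_insert, Equiv.coe_toEmbedding, currentSum_insert hq', currentSum_insert hq, ih,
      h, ← map_add, ih]

theorem currentRatio_map_equiv {E' ι' : Type*} {d' : ι' → E' →₀ ZMod 2} (φ : ι ≃ ι')
    (ψ : (E →₀ ZMod 2) ≃+ (E' →₀ ZMod 2)) (h : ∀ p, d' (φ p) = ψ (d p)) (P : Finset ι)
    (c : E →₀ ZMod 2) :
    currentRatio d' t (P.map φ.toEmbedding) (ψ c) = currentRatio d t P c := by
  unfold currentRatio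
  rw [currentSum_map_equiv φ ψ h, ← map_zero ψ, currentSum_map_equiv φ ψ h]

theorem currentRatio_singleton_pos (ht : 0 < t) (p : ι) : 0 < currentRatio d t {p} (d p) := by
  classical
  refine div_pos ?_ (currentSum_zero_pos ht.le _)
  rw [← insert_empty_eq, currentSum_insert (Finset.notMem_empty p), chain_add_self,
    currentSum_empty_zero, mul_one]
  exact add_pos_of_nonneg_of_pos (currentSum_nonneg ht.le _ _) ht

end CurrentSum

/-! ### Lattice chains modulo 2 and the expansion of the Wilson expectation -/

variable {m N : ℕ}

/-- Reduction of a chain modulo 2. -/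
def mod2 : Chain1 m →+ (Edge m →₀ ZMod 2) :=
  Finsupp.mapRange.addMonoidHom (Int.castAddHom (ZMod 2))

theorem mod2_apply (γ : Chain1 m) (e : Edge m) : mod2 γ e = (γ e : ZMod 2) := rfl

theorem mod2_single (e : Edge m) (a : ℤ) :
    mod2 (Finsupp.single e a) = Finsupp.single e (a : ZMod 2) := by
  ext e'
  rw [mod2_apply, Finsupp.single_apply, Finsupp.single_apply]
  split_ifs <;> simp

theorem support_mod2_subset (γ : Chain1 m) : (mod2 γ).support ⊆ γ.support := by
  intro e he
  rw [Finsupp.mem_support_iff, mod2_apply] at he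
  rw [Finsupp.mem_support_iff]
  intro h
  simp [h] at he

/-- The boundary of a plaquette modulo 2. -/
def boundary2 (p : Plaquette m) : Edge m →₀ ZMod 2 := mod2 (plaquetteBoundary p)

theorem boundary2_eq (p : Plaquette m) :
    boundary2 p = Finsupp.single (p.1, p.2.1) 1 + Finsupp.single (p.1 + unit p.2.1, p.2.2) 1
      + Finsupp.single (p.1 + unit p.2.2, p.2.1) 1 + Finsupp.single (p.1, p.2.2) 1 := by
  have hneg : ∀ a : Edge m →₀ ZMod 2, -a = a := fun a => by
    rw [neg_eq_iff_add_eq_zero, chain_add_self]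
  simp only [boundary2, plaquetteBoundary, sub_eq_add_neg, map_add, map_neg, mod2_single, hneg,
    Int.cast_one]

theorem boundary2_swap (v : Vertex m) (i j : Fin m) : boundary2 (v, j, i) = boundary2 (v, i, j) := by
  rw [boundary2_eq, boundary2_eq]
  abel

theorem boundary2_degenerate (v : Vertex m) (i : Fin m) : boundary2 (v, i, i) = 0 := by
  have : plaquetteBoundary (v, i, i) = 0 := by
    simp only [plaquetteBoundary]
    abel
  rw [boundary2, this, map_zero]

theorem unit_ne_zero (i : Fin m) : unit i ≠ (0 : Vertex m) := by
  intro h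
  simpa [unit] using congrFun h i

theorem mem_box {v : Vertex m} : v ∈ box m N ↔ ∀ i, -(N : ℤ) ≤ v i ∧ v i ≤ N := by
  simp [box, Pi.le_def, forall_and]

theorem mem_boxEdges {e : Edge m} :
    e ∈ boxEdges m N ↔ e.1 ∈ box m N ∧ e.1 + unit e.2 ∈ box m N := by
  simp [boxEdges]

theorem mem_boxPlaquettes {p : Plaquette m} :
    p ∈ boxPlaquettes m N ↔ p.1 ∈ box m N ∧ p.2.1 ≠ p.2.2 ∧ p.1 + unit p.2.1 ∈ box m N ∧
      p.1 + unit p.2.2 ∈ box m N ∧ p.1 + unit p.2.1 + unit p.2.2 ∈ box m N := by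
  simp [boxPlaquettes]

theorem support_plaquetteBoundary_subset {p : Plaquette m} (hp : p ∈ boxPlaquettes m N) :
    (plaquetteBoundary p).support ⊆ boxEdges m N := by
  obtain ⟨h0, -, h1, h2, h3⟩ := mem_boxPlaquettes.1 hp
  have hs : ∀ e ∈ boxEdges m N, (Finsupp.single e (1 : ℤ)).support ⊆ boxEdges m N := by
    intro e he
    exact Finsupp.support_single_subset.trans (Finset.singleton_subset_iff.2 he)
  unfold plaquetteBoundary
  refine Finsupp.support_sub.trans (Finset.union_subset (Finsupp.support_sub.trans
    (Finset.union_subset (Finsupp.support_add.trans (Finset.union_subset (hs _ ?_) (hs _ ?_)))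
      (hs _ ?_))) (hs _ ?_)) <;> rw [mem_boxEdges]
  · exact ⟨h0, h1⟩
  · exact ⟨h1, h3⟩
  · exact ⟨h2, by rwa [add_right_comm]⟩
  · exact ⟨h0, h2⟩

theorem support_boundary2_subset {p : Plaquette m} (hp : p ∈ boxPlaquettes m N) :
    (boundary2 p).support ⊆ boxEdges m N :=
  (support_mod2_subset _).trans (support_plaquetteBoundary_subset hp)

theorem evalChain_eq_pairing (σ : Config m N) (γ : Chain1 m) :
    evalChain σ γ = pairing σ (mod2 γ) := rfl

theorem exp_mul_rho (β : ℝ) (x : ZMod 2) :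
    Real.exp (β * rho x) = Real.cosh β * (Real.tanh β * rho x + 1) := by
  have h : Real.cosh β ≠ 0 := (Real.cosh_pos β).ne'
  rw [Real.tanh_eq_sinh_div_cosh]
  rcases rho_eq_one_or_neg_one x with hx | hx <;> rw [hx]
  · rw [mul_one, ← Real.cosh_add_sinh]
    field_simp
    ring
  · rw [mul_neg_one, ← Real.cosh_sub_sinh]
    field_simp
    ring

theorem exp_neg_mul_action (β : ℝ) (σ : Config m N) :
    Real.exp (-β * action σ) = Real.cosh β ^ (boxPlaquettes m N).card *
      ∏ p ∈ boxPlaquettes m N, (Real.tanh β * rho (pairing σ (boundary2 p)) + 1) := by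
  rw [← Finset.prod_const, ← Finset.prod_mul_distrib]
  simp_rw [← exp_mul_rho]
  rw [← Real.exp_sum, ← Finset.mul_sum, action, neg_mul_neg]
  rfl

/-- The powers of cosh β and the number 2^|edges| of configurations cancel between numerator and
partition function. The support condition matters: `evalChain` ignores edges outside the box, while
`mod2 γ` keeps them. -/
theorem expectation_wilson (β : ℝ) (γ : Chain1 m) (hγ : γ.support ⊆ boxEdges m N) :
    expectation m N β (wilson γ) =
      currentRatio boundary2 (Real.tanh β) (boxPlaquettes m N) (mod2 γ) := by
  have h1 := sum_rho_mul_prod_one_add boundary2 (Real.tanh β) (boxEdges m N) (boxPlaquettes m N)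
    (mod2 γ) ((support_mod2_subset γ).trans hγ) fun p hp => support_boundary2_subset hp
  have h2 := sum_rho_mul_prod_one_add boundary2 (Real.tanh β) (boxEdges m N) (boxPlaquettes m N)
    0 (by simp) fun p hp => support_boundary2_subset hp
  simp only [pairing_zero, rho_zero, one_mul] at h2
  have h3 : partition m N β = Real.cosh β ^ (boxPlaquettes m N).card * (2 ^ (boxEdges m N).card *
      currentSum boundary2 (Real.tanh β) (boxPlaquettes m N) 0) := by
    rw [← h2, Finset.mul_sum]
    exact Finset.sum_congr rfl fun σ _ => exp_neg_mul_action β σ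
  have h4 : expectation m N β (wilson γ) = (partition m N β)⁻¹ *
      (Real.cosh β ^ (boxPlaquettes m N).card * (2 ^ (boxEdges m N).card *
        currentSum boundary2 (Real.tanh β) (boxPlaquettes m N) (mod2 γ))) := by
    rw [← h1, Finset.mul_sum, Finset.mul_sum]
    refine Finset.sum_congr rfl fun σ _ => ?_
    rw [exp_neg_mul_action, wilson, evalChain_eq_pairing]
    ring
  have hc : Real.cosh β ≠ 0 := (Real.cosh_pos β).ne'
  rw [h4, h3, ← div_eq_inv_mul, mul_div_mul_left _ _ (pow_ne_zero _ hc),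
    mul_div_mul_left _ _ (by positivity)]
  rfl

/-! ### Counting plaquettes at an edge, and the area-law bound -/

theorem eq_of_boundary2_ne_zero {p : Plaquette m} {e : Edge m} (h : boundary2 p e ≠ 0) :
    e = (p.1, p.2.1) ∨ e = (p.1 + unit p.2.1, p.2.2) ∨ e = (p.1 + unit p.2.2, p.2.1) ∨
      e = (p.1, p.2.2) := by
  contrapose! h
  obtain ⟨h1, h2, h3, h4⟩ := h
  simp [boundary2_eq, h1.symm, h2.symm, h3.symm, h4.symm]

open scoped Classical in
theorem card_plaquettes_le (N : ℕ) (e : Edge m) :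
    ((boxPlaquettes m N).filter fun p => boundary2 p e ≠ 0).card ≤ 4 * (m - 1) := by
  obtain ⟨w, k⟩ := e
  set K : Finset (Fin m) := Finset.univ.erase k with hK
  have hcard : K.card = m - 1 := by simp [hK, Finset.card_erase_of_mem]
  -- For each direction l ≠ k the edge is either a side at the corner w or the opposite side of a
  -- plaquette with corner w - `unit l`, and each plaquette occurs with two orientations: four
  -- families of m - 1.
  have hsub : ((boxPlaquettes m N).filter fun p => boundary2 p (w, k) ≠ 0) ⊆
      (K.image (fun l => ((w, k, l) : Plaquette m)) ∪ K.image fun l => (w, l, k)) ∪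
        (K.image (fun l => (w - unit l, l, k)) ∪ K.image fun l => (w - unit l, k, l)) := by
    rintro ⟨v, i, j⟩ hp
    rw [Finset.mem_filter, mem_boxPlaquettes] at hp
    obtain ⟨⟨-, hij, -⟩, he⟩ := hp
    simp only at hij
    simp only [Finset.mem_union, Finset.mem_image, hK, Finset.mem_erase, Finset.mem_univ,
      and_true, Prod.mk.injEq]
    rcases eq_of_boundary2_ne_zero he with h | h | h | h <;>
      simp only [Prod.mk.injEq] at h <;> obtain ⟨rfl, rfl⟩ := h
    · exact Or.inl (Or.inl ⟨j, hij.symm, rfl, rfl, rfl⟩)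
    · exact Or.inr (Or.inl ⟨i, hij, by abel, rfl, rfl⟩)
    · exact Or.inr (Or.inr ⟨j, hij.symm, by abel, rfl, rfl⟩)
    · exact Or.inl (Or.inr ⟨i, hij, rfl, rfl, rfl⟩)
  have h1 := Finset.card_le_card hsub
  have hi : ∀ f : Fin m → Plaquette m, (K.image f).card ≤ m - 1 := fun f =>
    hcard ▸ Finset.card_image_le
  refine h1.trans ((Finset.card_union_le _ _).trans ?_)
  have h2 := Finset.card_union_le (K.image fun l => ((w, k, l) : Plaquette m))
    (K.image fun l => (w, l, k))
  have h3 := Finset.card_union_le (K.image fun l => ((w - unit l, l, k) : Plaquette m))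
    (K.image fun l => (w - unit l, k, l))
  have a1 := hi fun l => (w, k, l)
  have a2 := hi fun l => (w, l, k)
  have a3 := hi fun l => (w - unit l, l, k)
  have a4 := hi fun l => (w - unit l, k, l)
  omega

theorem tanh_nonneg {β : ℝ} (hβ : 0 ≤ β) : 0 ≤ Real.tanh β := by
  rw [Real.tanh_eq_sinh_div_cosh]
  exact div_nonneg (Real.sinh_nonneg_iff.2 hβ) (Real.cosh_pos β).le

theorem tanh_le_self {β : ℝ} (hβ : 0 ≤ β) : Real.tanh β ≤ β := by
  rw [Real.tanh_eq_sinh_div_cosh, div_le_iff₀ (Real.cosh_pos β)]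
  -- The function x cosh x - sinh x vanishes at 0 and has derivative x sinh x ≥ 0 on the half-line.
  have hd : ∀ x : ℝ, HasDerivAt (fun x => x * Real.cosh x - Real.sinh x) (x * Real.sinh x) x := by
    intro x
    have := ((hasDerivAt_id x).mul (Real.hasDerivAt_cosh x)).sub (Real.hasDerivAt_sinh x)
    refine this.congr_deriv ?_
    simp only [id]
    ring
  have hmono : MonotoneOn (fun x => x * Real.cosh x - Real.sinh x) (Set.Ici 0) := by
    refine monotoneOn_of_deriv_nonneg (convex_Ici 0)
      (fun x _ => (hd x).continuousAt.continuousWithinAt)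
      (fun x _ => (hd x).differentiableAt.differentiableWithinAt) fun x hx => ?_
    rw [interior_Ici, Set.mem_Ioi] at hx
    rw [(hd x).deriv]
    exact mul_nonneg hx.le (Real.sinh_nonneg_iff.2 hx.le)
  have := hmono Set.self_mem_Ici (Set.mem_Ici.2 hβ) hβ
  simpa using this

/-- A Wilson variable whose chain is not the sum of fewer than `k` plaquette boundaries has
expectation at most `(4 (m - 1) β) ^ k`. -/
theorem currentRatio_le_pow (hm : 1 ≤ m) {β : ℝ} (hβ : 0 ≤ β) (N k : ℕ) (c : Edge m →₀ ZMod 2)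
    (hc : ∀ s : Multiset (Plaquette m), (∀ p ∈ s, p ∈ boxPlaquettes m N) → s.card < k →
      (s.map boundary2).sum ≠ c) :
    currentRatio boundary2 (Real.tanh β) (boxPlaquettes m N) c ≤ (4 * ((m : ℝ) - 1) * β) ^ k := by
  have ht := tanh_nonneg hβ
  have hm' : (0 : ℝ) ≤ 4 * ((m : ℝ) - 1) := by
    have : (1 : ℝ) ≤ m := by exact_mod_cast hm
    linarith
  refine (div_le_iff₀ (currentSum_zero_pos ht _)).2 ?_
  refine (currentSum_le_pow ht (Real.tanh_lt_one β).le _ (4 * ((m : ℝ) - 1)) hm' (fun e => ?_)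
    k c hc).trans ?_
  · have := card_plaquettes_le N e
    rw [← Nat.cast_one, ← Nat.cast_sub hm]
    exact_mod_cast this
  · refine mul_le_mul_of_nonneg_right ?_ (currentSum_nonneg ht _ _)
    exact pow_le_pow_left₀ (mul_nonneg hm' ht) (mul_le_mul_of_nonneg_left (tanh_le_self hβ) hm') k

/-! ### Closed one-forms on a box are exact -/

theorem unit_same (i : Fin m) : unit i i = 1 := by simp [unit]

theorem unit_ne {i j : Fin m} (h : j ≠ i) : unit i j = 0 := by simp [unit, h]

theorem update_add_unit_same (v : Vertex m) (i : Fin m) (x : ℤ) :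
    Function.update (v + unit i) i x = Function.update v i x := by
  ext k
  by_cases hk : k = i
  · subst hk; simp
  · simp [hk, unit_ne hk]

theorem update_add_unit_ne (v : Vertex m) {i j : Fin m} (h : j ≠ i) (x : ℤ) :
    Function.update (v + unit j) i x = Function.update v i x + unit j := by
  ext k
  by_cases hk : k = i
  · subst hk; simp [unit_ne h.symm]
  · simp [hk]

theorem update_mem_box {v : Vertex m} (hv : v ∈ box m N) (i : Fin m) {x : ℤ}
    (h1 : -(N : ℤ) ≤ x) (h2 : x ≤ N) : Function.update v i x ∈ box m N := by
  rw [mem_box] at hv ⊢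
  intro k
  by_cases hk : k = i
  · subst hk; simpa using ⟨h1, h2⟩
  · simpa [hk] using hv k

theorem update_add_unit (v : Vertex m) (i : Fin m) (x : ℤ) :
    Function.update v i x + unit i = Function.update v i (x + 1) := by
  ext k
  by_cases hk : k = i
  · subst hk; simp [unit_same]
  · simp [hk, unit_ne hk]

/-- Poincaré lemma, by induction on the set s of directions in which ω already agrees with dg. The
remainder η = ω - dg is closed and vanishes in the directions of s; integrating it along direction i
from the face at height -N corrects direction i without disturbing s. Arbitrary coefficient groups
are allowed because a quotient of the chain group is used later. -/
theorem exists_potential {Q : Type*} [AddCommGroup Q] (ω : Vertex m → Fin m → Q)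
    (hω : ∀ v i j, (v, i, j) ∈ boxPlaquettes m N →
      ω v i + ω (v + unit i) j = ω v j + ω (v + unit j) i) :
    ∃ g : Vertex m → Q, ∀ v i, (v, i) ∈ boxEdges m N → ω v i = g (v + unit i) - g v := by
  suffices h : ∀ s : Finset (Fin m), ∃ g : Vertex m → Q, ∀ v, ∀ i ∈ s, (v, i) ∈ boxEdges m N →
      ω v i = g (v + unit i) - g v by
    obtain ⟨g, hg⟩ := h Finset.univ
    exact ⟨g, fun v i => hg v i (Finset.mem_univ i)⟩
  intro s
  induction s using Finset.induction_on with
  | empty => exact ⟨0, by simp⟩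
  | insert i s hi ih =>
    obtain ⟨g, hg⟩ := ih
    set η : Vertex m → Fin m → Q := fun v k => ω v k - (g (v + unit k) - g v) with hη
    have hηs : ∀ v, ∀ k ∈ s, (v, k) ∈ boxEdges m N → η v k = 0 := fun v k hk hv =>
      sub_eq_zero.2 (hg v k hk hv)
    have hηc : ∀ v i j, (v, i, j) ∈ boxPlaquettes m N →
        η v i + η (v + unit i) j = η v j + η (v + unit j) i := by
      intro v i j hv
      have := hω v i j hv
      simp only [hη, add_right_comm v (unit j) (unit i)]
      rw [sub_add_sub_comm, this]
      abel
    set h : Vertex m → Q := fun v => ∑ k ∈ Finset.range (v i + N).toNat,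
      η (Function.update v i (-(N : ℤ) + k)) i with hh
    refine ⟨g + h, fun v j hj hv => ?_⟩
    have hvb := mem_boxEdges.1 hv
    simp only at hvb
    have hdiff : η v j = h (v + unit j) - h v := by
      rcases Finset.mem_insert.1 hj with rfl | hjs
      · have h1 := (mem_box.1 hvb.1 j).1
        -- The bound -N ≤ v j ensures that `toNat` does not truncate, so the sum gains exactly one
        -- term.
        have h2 : ((v + unit j) j + (N : ℤ)).toNat = (v j + N).toNat + 1 := by
          rw [Pi.add_apply, unit_same]
          omega
        simp only [hh, h2, update_add_unit_same]
        rw [Finset.sum_range_succ, add_sub_cancel_left]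
        have h3 : -(N : ℤ) + ((v j + N).toNat : ℤ) = v j := by omega
        rw [h3, Function.update_eq_self]
      · have hji : j ≠ i := fun h => hi (h ▸ hjs)
        rw [hηs v j hjs hv, eq_comm, sub_eq_zero]
        simp only [hh, Pi.add_apply, unit_ne hji.symm, add_zero]
        refine Finset.sum_congr rfl fun k hk => ?_
        rw [Finset.mem_range] at hk
        have hb := mem_box.1 hvb.1 i
        rw [update_add_unit_ne v hji]
        have hu0 : Function.update v i (-(N : ℤ) + k) ∈ box m N :=
          update_mem_box hvb.1 i (by omega) (by omega)
        have hu1 : Function.update v i (-(N : ℤ) + k) + unit i ∈ box m N := by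
          rw [update_add_unit]
          exact update_mem_box hvb.1 i (by omega) (by omega)
        have hu2 : Function.update v i (-(N : ℤ) + k) + unit j ∈ box m N := by
          rw [← update_add_unit_ne v hji]
          exact update_mem_box hvb.2 i (by omega) (by omega)
        have hu3 : Function.update v i (-(N : ℤ) + k) + unit i + unit j ∈ box m N := by
          rw [update_add_unit, ← update_add_unit_ne v hji]
          exact update_mem_box hvb.2 i (by omega) (by omega)
        generalize Function.update v i (-(N : ℤ) + k) = u at hu0 hu1 hu2 hu3 ⊢
        -- Closedness together with the vanishing of η in direction j makes η in direction i
        -- invariant under a step in direction j.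
        have hc := hηc u i j (mem_boxPlaquettes.2 ⟨hu0, hji.symm, hu1, hu2, hu3⟩)
        rw [hηs _ j hjs (mem_boxEdges.2 ⟨hu0, hu2⟩), hηs _ j hjs (mem_boxEdges.2 ⟨hu1, hu3⟩),
          add_zero, zero_add] at hc
        exact hc.symm
    have : ω v j = η v j + (g (v + unit j) - g v) := by simp [hη]
    rw [this, hdiff, Pi.add_apply, Pi.add_apply]
    abel

/-! ### Currents -/

theorem boundary2_mem_span (N : ℕ) {p : Plaquette m} (hp : p ∈ boxPlaquettes m N) :
    boundary2 p ∈ Submodule.span (ZMod 2)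
      (Set.range fun q : boxPosPlaquettes m N => boundary2 q.1) := by
  obtain ⟨v, i, j⟩ := p
  have h := mem_boxPlaquettes.1 hp
  rcases lt_or_gt_of_ne h.2.1 with hij | hij
  · exact Submodule.subset_span ⟨⟨(v, i, j), Finset.mem_filter.2 ⟨hp, hij⟩⟩, rfl⟩
  · rw [← boundary2_swap]
    refine Submodule.subset_span ⟨⟨(v, j, i), Finset.mem_filter.2 ⟨mem_boxPlaquettes.2 ?_, hij⟩⟩,
      rfl⟩
    exact ⟨h.1, h.2.1.symm, h.2.2.2.1, h.2.2.1, by simpa [add_right_comm] using h.2.2.2.2⟩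

/-- Send each edge to its class modulo the span M of plaquette boundaries. This 1-form is closed by
the choice of M, hence equals dg; the class of γ is then g evaluated on ∂γ = 0. -/
theorem mod2_mem_span {γ : Chain1 m} (hγ : boundary γ = 0) (hN : γ.support ⊆ boxEdges m N) :
    mod2 γ ∈ Submodule.span (ZMod 2)
      (Set.range fun q : boxPosPlaquettes m N => boundary2 q.1) := by
  set M := Submodule.span (ZMod 2) (Set.range fun q : boxPosPlaquettes m N => boundary2 q.1)
    with hM
  have hclosed : ∀ v i j, (v, i, j) ∈ boxPlaquettes m N →
      M.mkQ (Finsupp.single (v, i) 1) + M.mkQ (Finsupp.single (v + unit i, j) 1) =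
        M.mkQ (Finsupp.single (v, j) 1) + M.mkQ (Finsupp.single (v + unit j, i) 1) := by
    intro v i j hv
    have h1 : M.mkQ (boundary2 (v, i, j)) = 0 := by
      rw [Submodule.mkQ_apply, Submodule.Quotient.mk_eq_zero]
      exact boundary2_mem_span N hv
    rw [← map_add, ← map_add, ← sub_eq_zero, ← map_sub, ← h1]
    congr 1
    have hneg : ∀ a : Edge m →₀ ZMod 2, -a = a := fun a => by
      rw [neg_eq_iff_add_eq_zero, chain_add_self]
    rw [boundary2_eq, sub_eq_add_neg, hneg]
    abel
  obtain ⟨g, hg⟩ := exists_potential (fun v i => M.mkQ (Finsupp.single (v, i) (1 : ZMod 2))) hclosed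
  set G : (Vertex m →₀ ℤ) →+ ((Edge m →₀ ZMod 2) ⧸ M) :=
    Finsupp.liftAddHom fun v => (zmultiplesHom _ (g v)) with hG
  have hGs : ∀ v a, G (Finsupp.single v a) = a • g v := fun v a => by simp [hG]
  rw [← Submodule.Quotient.mk_eq_zero, ← Submodule.mkQ_apply]
  have h2 : M.mkQ (mod2 γ) = G (boundary γ) := by
    conv_lhs => rw [← Finsupp.sum_single γ]
    unfold boundary Finsupp.sum
    rw [map_sum, map_sum, map_sum]
    refine Finset.sum_congr rfl fun e he => ?_
    have h3 : (Finsupp.single e (γ e) : Chain1 m) = γ e • Finsupp.single e 1 := by simp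
    rw [map_sub, hGs, hGs, ← smul_sub, ← hg e.1 e.2 (hN he), h3, map_zsmul, map_zsmul, mod2_single,
      Int.cast_one]
  rw [h2, hγ, map_zero]

/-- The four edges of a nondegenerate plaquette are distinct, so its boundary coefficients are 0 or
±1 and no incidence is lost modulo 2. -/
theorem boundary2_apply {p : Plaquette m} (hp : p.2.1 ≠ p.2.2) (e : Edge m) :
    boundary2 p e = if plaquetteBoundary p e ≠ 0 then 1 else 0 := by
  obtain ⟨v, i, j⟩ := p
  obtain ⟨w, k⟩ := e
  simp only at hp
  have hi : v + unit i ≠ v := by simpa using unit_ne_zero i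
  have hj : v + unit j ≠ v := by simpa using unit_ne_zero j
  rw [boundary2, mod2_apply]
  have hv : plaquetteBoundary (v, i, j) (w, k) = 0 ∨ plaquetteBoundary (v, i, j) (w, k) = 1 ∨
      plaquetteBoundary (v, i, j) (w, k) = -1 := by
    simp only [plaquetteBoundary, Finsupp.sub_apply, Finsupp.add_apply, Finsupp.single_apply,
      Prod.mk.injEq]
    by_cases h1 : i = k
    · have h2 : j ≠ k := fun h => hp (h1.trans h.symm)
      by_cases h3 : v = w
      · subst h3
        simp [h1, h2, hj]
      · simp only [h1, h2, h3]
        split_ifs <;> simp_all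
    · by_cases h3 : v = w
      · subst h3
        simp only [h1, hi]
        split_ifs <;> simp_all
      · simp only [h1, h3]
        split_ifs <;> simp_all
  rcases hv with h | h | h <;> rw [h] <;> simp

theorem mem_currents_iff {γ : Chain1 m} {n : Current m N} :
    n ∈ currents N γ ↔ ∀ e ∈ boxEdges m N,
      mod2 γ e = ∑ p : boxPosPlaquettes m N, (n p : ZMod 2) * boundary2 p.1 e := by
  refine forall₂_congr fun e _ => ?_
  refine (ZMod.intCast_eq_intCast_iff _ _ 2).symm.trans ?_
  rw [mod2_apply]
  push_cast
  have h1 : ∑ p : boxPosPlaquettes m N, (n p : ZMod 2) * boundary2 p.1 e =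
      ∑ p : boxPosPlaquettes m N with plaquetteBoundary p.1 e ≠ 0, (n p : ZMod 2) := by
    rw [Finset.sum_filter]
    refine Finset.sum_congr rfl fun p _ => ?_
    rw [boundary2_apply (mem_boxPlaquettes.1 (Finset.mem_filter.1 p.2).1).2.1]
    simp
  rw [h1]
  constructor
  · intro h
    rw [eq_neg_of_add_eq_zero_left h, CharTwo.neg_eq]
  · intro h
    rw [h, CharTwo.add_self_eq_zero]

theorem currents_nonempty {γ : Chain1 m} (hγ : boundary γ = 0) (hN : γ.support ⊆ boxEdges m N) :
    (currents N γ).Nonempty := by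
  obtain ⟨c, hc⟩ := (Submodule.mem_span_range_iff_exists_fun _).1 (mod2_mem_span hγ hN)
  refine ⟨fun p => (c p).val, mem_currents_iff.2 fun e _ => ?_⟩
  rw [← hc, Finsupp.finsetSum_apply]
  refine Finset.sum_congr rfl fun p _ => ?_
  simp

/-- The positively oriented version of a plaquette. -/
def orient (p : Plaquette m) : Plaquette m :=
  if p.2.1 < p.2.2 then p else (p.1, p.2.2, p.2.1)

theorem boundary2_orient (p : Plaquette m) : boundary2 (orient p) = boundary2 p := by
  unfold orient
  split_ifs
  · rfl
  · exact boundary2_swap _ _ _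

theorem orient_mem {p : Plaquette m} (hp : p ∈ boxPlaquettes m N) :
    orient p ∈ boxPosPlaquettes m N := by
  have h := mem_boxPlaquettes.1 hp
  unfold orient
  split_ifs with hlt
  · exact Finset.mem_filter.2 ⟨hp, hlt⟩
  · refine Finset.mem_filter.2 ⟨mem_boxPlaquettes.2 ?_,
      lt_of_le_of_ne (not_lt.1 hlt) h.2.1.symm⟩
    exact ⟨h.1, h.2.1.symm, h.2.2.2.1, h.2.2.1, by simpa [add_right_comm] using h.2.2.2.2⟩

/-- Modulo 2 orientations do not matter, so after orienting all plaquettes positively the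
multiplicity function of s is a current with source γ. -/
theorem area_le_card {γ : Chain1 m} {s : Multiset (Plaquette m)}
    (hs : ∀ p ∈ s, p ∈ boxPlaquettes m N) (h : (s.map boundary2).sum = mod2 γ) :
    area N γ ≤ s.card := by
  have hmem : ∀ q ∈ s.map orient, q ∈ boxPosPlaquettes m N := by
    intro q hq
    obtain ⟨p, hp, rfl⟩ := Multiset.mem_map.1 hq
    exact orient_mem (hs p hp)
  refine Nat.sInf_le ⟨fun p => (s.map orient).count p.1, mem_currents_iff.2 fun e _ => ?_, ?_⟩
  · have h1 : (s.map boundary2).sum = ((s.map orient).map boundary2).sum := by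
      rw [Multiset.map_map]
      congr 1
      exact Multiset.map_congr rfl fun p _ => (boundary2_orient p).symm
    rw [← h, h1, Finset.sum_multiset_map_count,
      Finset.sum_subset (fun q hq => hmem q (Multiset.mem_toFinset.1 hq)) fun q _ hq => by
        rw [Multiset.count_eq_zero_of_notMem (fun h => hq (Multiset.mem_toFinset.2 h)), zero_smul],
      Finsupp.finsetSum_apply, ← Finset.sum_coe_sort]
    refine Finset.sum_congr rfl fun p _ => ?_
    simp
  · rw [Finset.sum_coe_sort (boxPosPlaquettes m N) fun p => (s.map orient).count p,
      Multiset.sum_count_eq_card hmem, Multiset.card_map]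

/-! ### The infinite volume limit -/

/-- The infinite volume expectation of the Wilson variable of a mod 2 chain. -/
def infiniteRatio (t : ℝ) (c : Edge m →₀ ZMod 2) : ℝ :=
  ⨆ P : Finset (Plaquette m), currentRatio boundary2 t P c

theorem eventually_mem_box (v : Vertex m) : ∀ᶠ N : ℕ in atTop, v ∈ box m N := by
  simp_rw [mem_box]
  refine eventually_all.2 fun i => ?_
  filter_upwards [eventually_ge_atTop (v i).natAbs] with N hN
  omega

theorem eventually_mem_boxEdges (e : Edge m) : ∀ᶠ N : ℕ in atTop, e ∈ boxEdges m N := by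
  filter_upwards [eventually_mem_box e.1, eventually_mem_box (e.1 + unit e.2)] with N h1 h2
  exact mem_boxEdges.2 ⟨h1, h2⟩

theorem eventually_support_subset (γ : Chain1 m) :
    ∀ᶠ N : ℕ in atTop, γ.support ⊆ boxEdges m N :=
  (Filter.eventually_all_finset γ.support).2 fun e _ => eventually_mem_boxEdges e

theorem eventually_mem_boxPlaquettes (p : Plaquette m) :
    ∀ᶠ N : ℕ in atTop, p ∈ boxPlaquettes m N ∨ boundary2 p = 0 := by
  obtain ⟨v, i, j⟩ := p
  by_cases hij : i = j
  · subst hij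
    exact Eventually.of_forall fun N => Or.inr (boundary2_degenerate v i)
  · filter_upwards [eventually_mem_box v, eventually_mem_box (v + unit i),
      eventually_mem_box (v + unit j), eventually_mem_box (v + unit i + unit j)] with N h1 h2 h3 h4
    exact Or.inl (mem_boxPlaquettes.2 ⟨h1, hij, h2, h3, h4⟩)

theorem box_mono : Monotone (box m) := by
  intro N N' h v hv
  rw [mem_box] at hv ⊢
  intro i
  have := hv i
  omega

theorem boxPlaquettes_mono : Monotone (boxPlaquettes m) := by
  intro N N' h p hp
  rw [mem_boxPlaquettes] at hp ⊢
  have hb := box_mono (m := m) h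
  exact ⟨hb hp.1, hp.2.1, hb hp.2.2.1, hb hp.2.2.2.1, hb hp.2.2.2.2⟩

variable {t : ℝ}

theorem bddAbove_currentRatio (ht : 0 ≤ t) (ht1 : t ≤ 1) (c : Edge m →₀ ZMod 2) :
    BddAbove (Set.range fun P : Finset (Plaquette m) => currentRatio boundary2 t P c) :=
  ⟨1, Set.forall_mem_range.2 fun P => currentRatio_le_one ht ht1 P c⟩

theorem currentRatio_le_infiniteRatio (ht : 0 ≤ t) (ht1 : t ≤ 1) (P : Finset (Plaquette m))
    (c : Edge m →₀ ZMod 2) : currentRatio boundary2 t P c ≤ infiniteRatio t c :=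
  le_ciSup (bddAbove_currentRatio ht ht1 c) P

/-- The ratio increases along the boxes, and every finite set of plaquettes lies in some box up to
degenerate plaquettes, which do not count. -/
theorem tendsto_currentRatio (ht : 0 ≤ t) (ht1 : t ≤ 1) (c : Edge m →₀ ZMod 2) :
    Tendsto (fun N : ℕ => currentRatio boundary2 t (boxPlaquettes m N) c) atTop
      (𝓝 (infiniteRatio t c)) := by
  refine tendsto_atTop_isLUB (fun N N' h => currentRatio_mono ht ht1
    (fun p hp => Or.inl (boxPlaquettes_mono h hp)) c) ⟨?_, fun b hb => ?_⟩
  · rintro _ ⟨N, rfl⟩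
    exact currentRatio_le_infiniteRatio ht ht1 _ c
  · refine ciSup_le fun P => ?_
    obtain ⟨N, hN⟩ := ((Filter.eventually_all_finset P).2
      fun p _ => eventually_mem_boxPlaquettes p).exists
    exact (currentRatio_mono ht ht1 hN c).trans (hb ⟨N, rfl⟩)

theorem infiniteRatio_mul_le (ht : 0 ≤ t) (ht1 : t ≤ 1) (a b : Edge m →₀ ZMod 2) :
    infiniteRatio t a * infiniteRatio t b ≤ infiniteRatio t (a + b) :=
  le_of_tendsto_of_tendsto' ((tendsto_currentRatio ht ht1 a).mul (tendsto_currentRatio ht ht1 b))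
    (tendsto_currentRatio ht ht1 (a + b)) fun _ => currentRatio_mul_le ht ht1 _ a b

theorem infiniteRatio_le_one (ht : 0 ≤ t) (ht1 : t ≤ 1) (c : Edge m →₀ ZMod 2) :
    infiniteRatio t c ≤ 1 :=
  ciSup_le fun P => currentRatio_le_one ht ht1 P c

theorem infiniteRatio_zero (ht : 0 ≤ t) : infiniteRatio t (0 : Edge m →₀ ZMod 2) = 1 := by
  simp [infiniteRatio, currentRatio_zero ht]

theorem infiniteRatio_boundary2_pos (ht : 0 < t) (ht1 : t ≤ 1) (p : Plaquette m) :
    0 < infiniteRatio t (boundary2 p) :=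
  (currentRatio_singleton_pos ht p).trans_le (currentRatio_le_infiniteRatio ht.le ht1 _ _)

theorem tendsto_expectation {β : ℝ} (hβ : 0 ≤ β) (γ : Chain1 m) :
    Tendsto (fun N : ℕ => expectation m N β (wilson γ)) atTop
      (𝓝 (infiniteRatio (Real.tanh β) (mod2 γ))) := by
  refine (tendsto_currentRatio (tanh_nonneg hβ) (Real.tanh_lt_one β).le (mod2 γ)).congr' ?_
  filter_upwards [eventually_support_subset γ] with N hN
  exact (expectation_wilson β γ hN).symm

theorem wilsonLimit_eq {β : ℝ} (hβ : 0 ≤ β) (γ : Chain1 m) :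
    wilsonLimit m β γ = infiniteRatio (Real.tanh β) (mod2 γ) :=
  (tendsto_expectation hβ γ).limUnder_eq

/-! ### Lattice symmetries -/

/-- The lattice automorphism that permutes the coordinates by `π` and then translates by `a`. -/
def vertexEquiv (π : Equiv.Perm (Fin m)) (a : Vertex m) : Vertex m ≃ Vertex m :=
  (Equiv.arrowCongr π (Equiv.refl ℤ)).trans (Equiv.addRight a)

theorem vertexEquiv_apply (π : Equiv.Perm (Fin m)) (a v : Vertex m) (k : Fin m) :
    vertexEquiv π a v k = v (π.symm k) + a k := rfl

theorem vertexEquiv_add_nsmul_unit (π : Equiv.Perm (Fin m)) (a v : Vertex m) (i : Fin m) (n : ℕ) :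
    vertexEquiv π a (v + n • unit i) = vertexEquiv π a v + n • unit (π i) := by
  ext k
  simp only [vertexEquiv_apply, Pi.add_apply, Pi.smul_apply, unit, Pi.single_apply,
    Equiv.symm_apply_eq]
  ring

theorem vertexEquiv_add_unit (π : Equiv.Perm (Fin m)) (a v : Vertex m) (i : Fin m) :
    vertexEquiv π a (v + unit i) = vertexEquiv π a v + unit (π i) := by
  simpa using vertexEquiv_add_nsmul_unit π a v i 1

/-- The action of a lattice automorphism on mod 2 chains. -/
def chainEquiv (π : Equiv.Perm (Fin m)) (a : Vertex m) :
    (Edge m →₀ ZMod 2) ≃+ (Edge m →₀ ZMod 2) :=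
  Finsupp.domCongr (Equiv.prodCongr (vertexEquiv π a) π)

theorem chainEquiv_single (π : Equiv.Perm (Fin m)) (a v : Vertex m) (i : Fin m) (x : ZMod 2) :
    chainEquiv π a (Finsupp.single (v, i) x) = Finsupp.single (vertexEquiv π a v, π i) x := by
  simp [chainEquiv, Finsupp.equivMapDomain_single]

theorem boundary2_map (π : Equiv.Perm (Fin m)) (a : Vertex m) (p : Plaquette m) :
    boundary2 (Equiv.prodCongr (vertexEquiv π a) (Equiv.prodCongr π π) p) =
      chainEquiv π a (boundary2 p) := by
  obtain ⟨v, i, j⟩ := p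
  simp [boundary2_eq, chainEquiv_single, vertexEquiv_add_unit]

/-- A translation moves the boxes but only permutes the finite sets of plaquettes, so the invariance
is immediate from the supremum. -/
theorem infiniteRatio_chainEquiv (π : Equiv.Perm (Fin m)) (a : Vertex m)
    (c : Edge m →₀ ZMod 2) : infiniteRatio t (chainEquiv π a c) = infiniteRatio t c := by
  refine ((Equiv.prodCongr (vertexEquiv π a) (Equiv.prodCongr π π)).finsetCongr.surjective.iSup_congr
    _ fun P => ?_).symm
  exact currentRatio_map_equiv _ (chainEquiv π a) (boundary2_map π a) P c

theorem mod2_rectangle_map (π : Equiv.Perm (Fin m)) (a v : Vertex m) (i j : Fin m) (R T : ℕ) :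
    mod2 (rectangle (vertexEquiv π a v) (π i) (π j) R T) =
      chainEquiv π a (mod2 (rectangle v i j R T)) := by
  simp only [rectangle, map_add, map_sub, map_sum, mod2_single, Int.cast_one, chainEquiv_single,
    vertexEquiv_add_nsmul_unit]

theorem exists_perm_apply_eq {α : Type*} [DecidableEq α] {i j i' j' : α} (h : i ≠ j)
    (h' : i' ≠ j') : ∃ π : Equiv.Perm α, π i = i' ∧ π j = j' := by
  refine ⟨(Equiv.swap i i').trans (Equiv.swap (Equiv.swap i i' j) j'), ?_, by simp⟩
  rw [Equiv.trans_apply, Equiv.swap_apply_left]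
  refine Equiv.swap_apply_of_ne_of_ne (fun h1 => h ?_) h'
  rw [← Equiv.swap_apply_left i i'] at h1
  exact (Equiv.swap i i').injective (by simpa using h1)

theorem infiniteRatio_rectangle_eq (v v' : Vertex m) {i j i' j' : Fin m} (h : i ≠ j)
    (h' : i' ≠ j') (R T : ℕ) :
    infiniteRatio t (mod2 (rectangle v' i' j' R T)) =
      infiniteRatio t (mod2 (rectangle v i j R T)) := by
  obtain ⟨π, rfl, rfl⟩ := exists_perm_apply_eq h h'
  -- The translation is chosen to carry the permuted corner to v'.
  have hv : vertexEquiv π (v' - vertexEquiv π 0 v) v = v' := by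
    ext k
    simp [vertexEquiv_apply]
  rw [← hv, mod2_rectangle_map, infiniteRatio_chainEquiv]

/-! ### Rectangles -/

/-- The common side of the two adjacent rectangles cancels. -/
theorem rectangle_add_right (v : Vertex m) (i j : Fin m) (R S T : ℕ) :
    rectangle v i j R (S + T) = rectangle v i j R S + rectangle (v + S • unit j) i j R T := by
  have h1 : ∀ n : ℕ, v + S • unit j + R • unit i + n • unit j =
      v + R • unit i + (S + n) • unit j := fun n => by
    rw [add_smul]
    abel
  simp only [rectangle, Finset.sum_range_add, h1]
  simp only [add_smul, add_assoc]
  abel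

theorem rectangle_add_left (v : Vertex m) (i j : Fin m) (R S T : ℕ) :
    rectangle v i j (R + S) T = rectangle v i j R T + rectangle (v + R • unit i) i j S T := by
  have h1 : ∀ n : ℕ, v + R • unit i + T • unit j + n • unit i =
      v + T • unit j + (R + n) • unit i := fun n => by
    rw [add_smul]
    abel
  simp only [rectangle, Finset.sum_range_add, h1]
  simp only [add_smul, add_assoc]
  abel

theorem rectangle_zero_right (v : Vertex m) (i j : Fin m) (R : ℕ) : rectangle v i j R 0 = 0 := by
  simp [rectangle]

theorem rectangle_zero_left (v : Vertex m) (i j : Fin m) (T : ℕ) : rectangle v i j 0 T = 0 := by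
  simp [rectangle]

theorem rectangle_one_one (v : Vertex m) (i j : Fin m) :
    rectangle v i j 1 1 = plaquetteBoundary (v, i, j) := by
  simp [rectangle, plaquetteBoundary]

/-- The rectangle is tiled by unit squares; each has positive expectation, and supermultiplicativity
carries this over to their sum. This makes real logarithms usable. -/
theorem infiniteRatio_rectangle_pos (ht : 0 < t) (ht1 : t ≤ 1) (v : Vertex m) (i j : Fin m)
    (R T : ℕ) : 0 < infiniteRatio t (mod2 (rectangle v i j R T)) := by
  have hmul : ∀ a b : Edge m →₀ ZMod 2, 0 < infiniteRatio t a → 0 < infiniteRatio t b →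
      0 < infiniteRatio t (a + b) := fun a b ha hb =>
    (mul_pos ha hb).trans_le (infiniteRatio_mul_le ht.le ht1 a b)
  have h1 : ∀ (v : Vertex m) (R : ℕ), 0 < infiniteRatio t (mod2 (rectangle v i j R 1)) := by
    intro v R
    induction R with
    | zero =>
      rw [rectangle_zero_left, map_zero, infiniteRatio_zero ht.le]
      exact one_pos
    | succ R ih =>
      rw [rectangle_add_left, map_add, rectangle_one_one]
      exact hmul _ _ ih (infiniteRatio_boundary2_pos ht ht1 _)
  induction T with
  | zero =>
    rw [rectangle_zero_right, map_zero, infiniteRatio_zero ht.le]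
    exact one_pos
  | succ T ih =>
    rw [rectangle_add_right, map_add]
    exact hmul _ _ ih (h1 _ R)

/-! ### Plaquettes needed to span a rectangle -/

/-- The one-form supported on the edges in direction `i` at height `x` in direction `i` and at
height at most `y` in direction `j`. -/
def halfPlaneForm (i j : Fin m) (x y : ℤ) : (Edge m →₀ ZMod 2) →+ ZMod 2 :=
  Finsupp.liftAddHom fun e =>
    if e.2 = i ∧ e.1 i = x ∧ e.1 j ≤ y then AddMonoidHom.id (ZMod 2) else 0

theorem halfPlaneForm_single (i j : Fin m) (x y : ℤ) (e : Edge m) :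
    halfPlaneForm i j x y (Finsupp.single e 1) =
      if e.2 = i ∧ e.1 i = x ∧ e.1 j ≤ y then 1 else 0 := by
  rw [halfPlaneForm, Finsupp.liftAddHom_apply_single]
  split_ifs <;> rfl

theorem halfPlaneForm_boundary2_aux {i j : Fin m} {x y : ℤ} {w : Vertex m} {l : Fin m}
    (hl : l ≠ i) (h : halfPlaneForm i j x y (boundary2 (w, i, l)) ≠ 0) : w i = x ∧ w j = y := by
  simp only [boundary2_eq, map_add, halfPlaneForm_single, hl, Pi.add_apply, unit_ne hl.symm,
    add_zero, false_and, if_false, true_and] at h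
  by_cases hlj : l = j
  · subst hlj
    rw [unit_same] at h
    by_contra hxy
    refine h ?_
    by_cases h1 : w i = x ∧ w l ≤ y
    · have h2 : w i = x ∧ w l + 1 ≤ y := by omega
      rw [if_pos h1, if_pos h2]
      exact CharTwo.add_self_eq_zero _
    · have h2 : ¬(w i = x ∧ w l + 1 ≤ y) := by omega
      rw [if_neg h1, if_neg h2, add_zero]
  · rw [unit_ne (Ne.symm hlj), add_zero, CharTwo.add_self_eq_zero] at h
    exact absurd rfl h

/-- Modulo 2, the two i-edges of a plaquette spanned by i and another direction cancel unless the
cutoff at height y in direction j separates them. So the coboundary lives only over the point (x, y)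
of the (i, j)-plane. -/
theorem halfPlaneForm_boundary2 {i j : Fin m} {x y : ℤ} {p : Plaquette m}
    (h : halfPlaneForm i j x y (boundary2 p) ≠ 0) : p.1 i = x ∧ p.1 j = y := by
  obtain ⟨w, k, l⟩ := p
  by_cases hkl : k = l
  · subst hkl
    rw [boundary2_degenerate, map_zero] at h
    exact absurd rfl h
  by_cases hk : k = i
  · subst hk
    exact halfPlaneForm_boundary2_aux (Ne.symm hkl) h
  by_cases hl : l = i
  · subst hl
    rw [boundary2_swap] at h
    exact halfPlaneForm_boundary2_aux hk h
  · simp [boundary2_eq, halfPlaneForm_single, hk, hl] at h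

/-- Of the whole rectangle only the a-th edge of the side at height v j counts: the opposite side
has height v j + T, above the cutoff since b < T. -/
theorem halfPlaneForm_rectangle {i j : Fin m} (hij : i ≠ j) (v : Vertex m) {R T a b : ℕ}
    (ha : a < R) (hb : b < T) :
    halfPlaneForm i j (v i + a) (v j + b) (mod2 (rectangle v i j R T)) = 1 := by
  have h1 : ∀ k : ℕ, ((v + k • unit i) i = v i + a ∧ (v + k • unit i) j ≤ v j + b) ↔ k = a := by
    intro k
    simp [unit_same, unit_ne hij.symm]
  have h2 : ∀ k : ℕ, ¬((v + T • unit j + k • unit i) i = v i + a ∧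
      (v + T • unit j + k • unit i) j ≤ v j + b) := by
    intro k
    simp [unit_same, unit_ne hij.symm]
    omega
  simp only [rectangle, map_add, map_sub, map_sum, mod2_single, Int.cast_one,
    halfPlaneForm_single, hij.symm, false_and, if_false, true_and, h1, h2]
  simp [ha]

/-- A mod 2 surface spanning an `R × T` rectangle has at least `R T` plaquettes. -/
theorem mul_le_card_of_sum_eq_rectangle {i j : Fin m} (hij : i ≠ j) (v : Vertex m) (R T : ℕ)
    (s : Multiset (Plaquette m)) (hs : (s.map boundary2).sum = mod2 (rectangle v i j R T)) :
    R * T ≤ s.card := by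
  set f : ℕ × ℕ → ℤ × ℤ := fun q => (v i + q.1, v j + q.2) with hf
  have hinj : Function.Injective f := by
    rintro ⟨a, b⟩ ⟨a', b'⟩ h
    simpa [hf] using h
  -- Each of the RT forms must be nonzero on some plaquette of s, and that plaquette projects to the
  -- point (v i + a, v j + b); distinct points need distinct plaquettes.
  have hsub : (Finset.range R ×ˢ Finset.range T).image f ⊆
      (s.map fun p => (p.1 i, p.1 j)).toFinset := by
    intro q hq
    obtain ⟨⟨a, b⟩, hab, rfl⟩ := Finset.mem_image.1 hq
    rw [Finset.mem_product, Finset.mem_range, Finset.mem_range] at hab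
    have h1 := halfPlaneForm_rectangle hij v hab.1 hab.2
    rw [← hs, map_multiset_sum, Multiset.map_map] at h1
    obtain ⟨p, hp, hp0⟩ : ∃ p ∈ s, halfPlaneForm i j (v i + a) (v j + b) (boundary2 p) ≠ 0 := by
      by_contra! hcon
      rw [Multiset.sum_eq_zero] at h1
      · exact zero_ne_one h1
      · intro x hx
        obtain ⟨p, hp, rfl⟩ := Multiset.mem_map.1 hx
        exact hcon p hp
    obtain ⟨hx, hy⟩ := halfPlaneForm_boundary2 hp0
    rw [Multiset.mem_toFinset, Multiset.mem_map]
    exact ⟨p, hp, by rw [hx, hy]⟩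
  have h2 := (Finset.card_le_card hsub).trans (Multiset.toFinset_card_le _)
  rwa [Finset.card_image_of_injective _ hinj, Finset.card_product, Finset.card_range,
    Finset.card_range, Multiset.card_map] at h2

theorem infiniteRatio_rectangle_le (hm : 1 ≤ m) {β : ℝ} (hβ : 0 ≤ β) {i j : Fin m} (hij : i ≠ j)
    (v : Vertex m) (R T : ℕ) :
    infiniteRatio (Real.tanh β) (mod2 (rectangle v i j R T)) ≤
      (4 * ((m : ℝ) - 1) * β) ^ (R * T) := by
  refine le_of_tendsto' (tendsto_currentRatio (tanh_nonneg hβ) (Real.tanh_lt_one β).le _)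
    fun N => currentRatio_le_pow hm hβ N (R * T) _ fun s _ hcard hsum => ?_
  exact (mul_le_card_of_sum_eq_rectangle hij v R T s hsum).not_gt hcard

/-! ### Fekete's lemma and the quark potential -/

/-- The quark potential exists at positive inverse temperature. -/
theorem exists_tendsto_log_rectangle (ht : 0 < t) (ht1 : t ≤ 1) {i j : Fin m} (hij : i ≠ j)
    (v : Vertex m) (R : ℕ) :
    ∃ V : ℝ, Tendsto (fun T : ℕ =>
      -Real.log (infiniteRatio t (mod2 (rectangle v i j R T))) / T) atTop (𝓝 V) := by
  have hpos := infiniteRatio_rectangle_pos ht ht1 v i j R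
  have hsub : Subadditive fun T : ℕ =>
      -Real.log (infiniteRatio t (mod2 (rectangle v i j R T))) := by
    intro S T
    have h1 := infiniteRatio_mul_le ht.le ht1 (mod2 (rectangle v i j R S))
      (mod2 (rectangle (v + S • unit j) i j R T))
    -- The second rectangle starts at a shifted corner; translation invariance moves it back.
    rw [← map_add, ← rectangle_add_right, infiniteRatio_rectangle_eq v (v + S • unit j) hij hij] at h1
    have h2 := Real.log_le_log (mul_pos (hpos S) (hpos T)) h1
    rw [Real.log_mul (hpos S).ne' (hpos T).ne'] at h2
    linarith
  have hbdd : BddBelow (Set.range fun T : ℕ =>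
      -Real.log (infiniteRatio t (mod2 (rectangle v i j R T))) / T) := by
    refine ⟨0, ?_⟩
    rintro _ ⟨T, rfl⟩
    exact div_nonneg
      (neg_nonneg.2 (Real.log_nonpos (hpos T).le (infiniteRatio_le_one ht.le ht1 _)))
      (Nat.cast_nonneg T)
  exact ⟨hsub.lim, hsub.tendsto_lim hbdd⟩

theorem exists_quarkPotential (hm : 2 ≤ m) {β : ℝ} (hβ : 0 ≤ β) {R : ℕ} (hR : 1 ≤ R) :
    ∃ V : EReal, IsQuarkPotential m β R V ∧
      ENNReal.log (1 / ENNReal.ofReal (4 * ((m : ℝ) - 1) * β)) * (R : EReal) ≤ V := by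
  have hm1 : 1 ≤ m := by omega
  rcases hβ.eq_or_lt with rfl | hβ
  · refine ⟨⊤, fun v i j hij => ?_, le_top⟩
    refine tendsto_const_nhds.congr' ?_
    filter_upwards [eventually_ge_atTop 1] with T hT
    -- At β = 0 the area bound is a positive power of 0 once T ≥ 1, so the Wilson expectation is 0
    -- and the potential is +∞.
    have h0 := infiniteRatio_rectangle_le hm1 le_rfl hij v R T
    rw [mul_zero, zero_pow (Nat.mul_ne_zero (by omega) (by omega))] at h0
    rw [wilsonLimit_eq le_rfl, ENNReal.ofReal_of_nonpos h0, ENNReal.log_zero, EReal.neg_bot,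
      EReal.top_div_of_pos_ne_top (by exact_mod_cast hT) (EReal.natCast_ne_top T)]
  · have ht : 0 < Real.tanh β := by
      rw [Real.tanh_eq_sinh_div_cosh]
      exact div_pos (Real.sinh_pos_iff.2 hβ) (Real.cosh_pos β)
    have ht1 := (Real.tanh_lt_one β).le
    let i₀ : Fin m := ⟨0, by omega⟩
    let j₀ : Fin m := ⟨1, by omega⟩
    have hij₀ : i₀ ≠ j₀ := by simp [i₀, j₀]
    obtain ⟨V, hV⟩ := exists_tendsto_log_rectangle ht ht1 hij₀ 0 R
    refine ⟨(V : EReal), fun v i j hij => ?_, ?_⟩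
    · have hcoe := (continuous_coe_real_ereal.tendsto V).comp hV
      refine hcoe.congr fun T => ?_
      rw [wilsonLimit_eq hβ.le, infiniteRatio_rectangle_eq 0 v hij₀ hij, Function.comp_apply,
        ENNReal.log_ofReal_of_pos (infiniteRatio_rectangle_pos ht ht1 _ _ _ _ _), EReal.coe_div,
        EReal.coe_neg]
      rfl
    · have hx : 0 < 4 * ((m : ℝ) - 1) * β := by
        have : (2 : ℝ) ≤ m := by exact_mod_cast hm
        have : (0 : ℝ) < 4 * ((m : ℝ) - 1) := by linarith
        positivity
      have hlog : ENNReal.log (1 / ENNReal.ofReal (4 * ((m : ℝ) - 1) * β)) * (R : EReal) =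
          ((-Real.log (4 * ((m : ℝ) - 1) * β) * R : ℝ) : EReal) := by
        rw [one_div, ← ENNReal.ofReal_inv_of_pos hx, ENNReal.log_ofReal_of_pos (inv_pos.2 hx),
          Real.log_inv, EReal.coe_mul]
        rfl
      rw [hlog, EReal.coe_le_coe_iff]
      refine ge_of_tendsto hV ?_
      filter_upwards [eventually_ge_atTop 1] with T hT
      have hT0 : (0 : ℝ) < T := by exact_mod_cast hT
      rw [le_div_iff₀ hT0]
      have h1 := Real.log_le_log (infiniteRatio_rectangle_pos ht ht1 0 i₀ j₀ R T)
        (infiniteRatio_rectangle_le hm1 hβ.le hij₀ 0 R T)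
      rw [Real.log_pow] at h1
      push_cast at h1
      linarith

end IsingGauge

end

theorem mainTheorem6 (m : ℕ) (hm : 3 ≤ m) (β : ℝ) (hβ0 : 0 ≤ β)
    (hβ : β < 1 / (4 * ((m : ℝ) - 1))) :
    (∀ (N : ℕ), 1 ≤ N → ∀ γ : IsingGauge.Chain1 m, IsingGauge.IsLoop γ →
      γ.support ⊆ IsingGauge.boxEdges m N →
        (IsingGauge.currents N γ).Nonempty ∧
        IsingGauge.expectation m N β (IsingGauge.wilson γ) ≤
          (4 * ((m : ℝ) - 1) * β) ^ IsingGauge.area N γ / (1 - 4 * ((m : ℝ) - 1) * β)) ∧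
    (∀ γ : IsingGauge.Chain1 m, IsingGauge.IsLoop γ →
      Tendsto (fun N : ℕ => IsingGauge.expectation m N β (IsingGauge.wilson γ)) atTop
        (𝓝 (IsingGauge.wilsonLimit m β γ))) ∧
    (∀ R : ℕ, 1 ≤ R → ∃ V : EReal, IsingGauge.IsQuarkPotential m β R V ∧
      ENNReal.log (1 / ENNReal.ofReal (4 * ((m : ℝ) - 1) * β)) * (R : EReal) ≤ V) := by
  have hm' : (0 : ℝ) < 4 * ((m : ℝ) - 1) := by
    have : (3 : ℝ) ≤ m := by exact_mod_cast hm
    linarith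
  refine ⟨fun N _ γ hγ hN => ⟨IsingGauge.currents_nonempty hγ.2 hN, ?_⟩, fun γ _ => ?_,
    fun R hR => IsingGauge.exists_quarkPotential (by omega) hβ0 hR⟩
  · have h0 : 0 ≤ 4 * ((m : ℝ) - 1) * β := mul_nonneg hm'.le hβ0
    have h1 : 4 * ((m : ℝ) - 1) * β < 1 := by
      rw [mul_comm]
      exact (lt_div_iff₀ hm').1 hβ
    rw [IsingGauge.expectation_wilson β γ hN]
    refine (IsingGauge.currentRatio_le_pow (by omega) hβ0 N (IsingGauge.area N γ) _
      fun s hs hcard hsum => (IsingGauge.area_le_card hs hsum).not_gt hcard).trans ?_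
    -- The area bound already holds without the denominator, which lies in (0, 1].
    exact le_div_self (pow_nonneg h0 _) (by linarith) (by linarith)
  · rw [IsingGauge.wilsonLimit_eq hβ0]
    exact IsingGauge.tendsto_expectation hβ0 γ
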